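/- A double occurrence word is a finite sequence in which every letter that appears does so exactly twice. Its interlacement graph has the letters as vertices, two distinct letters $a,b$ being adjacent if and only if they appear in the word in the order $abab$ or $baba$. A circle graph is a simple graph that is isomorphic to the interlacement graph of a double occurrence word. A split $(V_1,X_1;V_2,X_2)$ of a simple graph $G$ is given by a partition $V(G)=V_1\cup V_2$ with $|V_1|,|V_2|\ge 2$ and subsets $X_i\subseteq V_i$ such that the edges of $G$ between $V_1$ and $V_2$ are exactly the pairs $x_1x_2$ with $x_1\in X_1$, $x_2\in X_2$. A graph is prime if it has at least five vertices and has no split. Let $G$ be a (finite) 3-regular circle graph. Then $G$ is not prime. -/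

import Mathlib

/-- `W` is a double occurrence word whose set of letters is `V`: every element of `V` occurs in `W`
exactly twice. -/
def IsDoubleOccurrenceWord {V : Type*} [DecidableEq V] (W : List V) : Prop :=
  ∀ v : V, W.count v = 2

/-- The interlacement graph of a word: distinct letters `a` and `b` are adjacent when they
appear in the word in the order `abab` or `baba`. -/
def interlacementGraph {V : Type*} (W : List V) : SimpleGraph V where
  Adj a b := a ≠ b ∧ (List.Sublist [a, b, a, b] W ∨ List.Sublist [b, a, b, a] W)
  symm := ⟨fun _ _ h => ⟨h.1.symm, h.2.symm⟩⟩
  loopless := ⟨fun _ h => h.1 rfl⟩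

/-- A circle graph is a simple graph that is the interlacement graph of a double occurrence word
(whose letters label the vertices). -/
def IsCircleGraph {V : Type*} [DecidableEq V] (G : SimpleGraph V) : Prop :=
  ∃ W : List V, IsDoubleOccurrenceWord W ∧ interlacementGraph W = G

/-- `(V₁, X₁; V₂, X₂)` is a split of `G`: the vertex set is partitioned into `V₁` and `V₂`, both with
at least two elements, `Xᵢ ⊆ Vᵢ`, and the edges of `G` between `V₁` and `V₂` are exactly those of
the complete bipartite graph with vertex classes `X₁` and `X₂`. -/
structure IsSplit {V : Type*} (G : SimpleGraph V) (V₁ X₁ V₂ X₂ : Set V) : Prop where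
  union_eq : V₁ ∪ V₂ = Set.univ
  disjoint : Disjoint V₁ V₂
  two_le_left : 2 ≤ V₁.encard
  two_le_right : 2 ≤ V₂.encard
  subset_left : X₁ ⊆ V₁
  subset_right : X₂ ⊆ V₂
  adj_iff : ∀ a ∈ V₁, ∀ b ∈ V₂, G.Adj a b ↔ a ∈ X₁ ∧ b ∈ X₂

/-- A graph is prime if it has at least five vertices and has no split. -/
def IsPrimeGraph {V : Type*} (G : SimpleGraph V) : Prop :=
  5 ≤ ENat.card V ∧ ¬ ∃ V₁ X₁ V₂ X₂ : Set V, IsSplit G V₁ X₁ V₂ X₂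

/-! Read the word cyclically, with period N = 2|V|, and call two occurrences of a letter a chord. By
regularity each side of each chord has exactly three positions whose letter recurs on the other
side. In a prime graph there are no twins, so no two chords can have adjacent ends at both ends.
Strong induction on the length of a side shows that it is `Small`: if all inner chords are small,
they have length four (`inner_eq_four`). Then counting single positions near both ends bounds the
side by eight (`small_of_inner_eq_four`). The chord through the midpoint rules out length eight, so
both sides of any chord have length four and N = 8. This means |V| = 4, against |V| ≥ 5. -/

/-- A periodic sequence of period `N` in which every letter that occurs does so exactly twice in
each period. -/
structure IsCyclicDoubleOccurrence {V : Type*} (f : ℕ → V) (N : ℕ) : Prop where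
  periodic : ∀ i, f (i + N) = f i
  exists_partner : ∀ i, ∃ k, 0 < k ∧ k < N ∧ f (i + k) = f i
  not_three : ∀ a b c, a < b → b < c → c < a + N → f a = f b → f b = f c → False

/-- The positions strictly between `i` and `i + k` whose letter also occurs strictly between
`i + k` and `i + N`. -/
def singlePositions {V : Type*} [DecidableEq V] (f : ℕ → V) (N i k : ℕ) : Finset ℕ :=
  {p ∈ Finset.Ioo i (i + k) | ∃ q ∈ Finset.Ioo (i + k) (i + N), f q = f p}

/-! ### Chords of a cyclic double occurrence sequence. -/

namespace IsCyclicDoubleOccurrence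

variable {V : Type*} {f : ℕ → V} {N : ℕ}

/-- The next occurrence of the letter of `p` cannot be an end of the chord, which would then be a
third occurrence. If it passes `i + N`, it is moved back by one period. -/
lemma exists_other (h : IsCyclicDoubleOccurrence f N) {i k p : ℕ} (hk : k < N)
    (hik : f (i + k) = f i) (hp : i < p) (hpk : p < i + k) :
    (∃ q, i < q ∧ q < i + k ∧ q ≠ p ∧ f q = f p) ∨ ∃ q, i + k < q ∧ q < i + N ∧ f q = f p := by
  obtain ⟨m, hm0, hmN, hm⟩ := h.exists_partner p
  have hper := h.periodic
  have h1 : p + m ≠ i + k := fun e => h.not_three i p (i + k) hp hpk (by omega)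
    (by rw [← hik, ← e, hm]) (by rw [← e, hm])
  have h2 : p + m ≠ i + N := fun e => h.not_three i p (i + k) hp hpk (by omega)
    (by rw [← hm, e, hper]) (by rw [hik, ← hm, e, hper])
  rcases lt_or_ge (p + m) (i + k) with h3 | h3
  · exact Or.inl ⟨p + m, by omega, h3, by omega, hm⟩
  rcases lt_or_ge (p + m) (i + N) with h4 | h4
  · exact Or.inr ⟨p + m, by omega, h4, hm⟩
  · refine Or.inl ⟨p + m - N, by omega, by omega, by omega, ?_⟩
    rw [← hm, ← hper (p + m - N)]
    congr 1
    omega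

/-- The chord joining positions `i` and `i + k` has one of two small shapes. -/
def Small (f : ℕ → V) (i k : ℕ) : Prop :=
  k = 4 ∨ k = 8 ∧ f (i + 1) = f (i + 5) ∧ f (i + 3) = f (i + 7)

/-- Length four would give the midpoint the letter of the ends; the second shape would repeat the
letter of `i + 1` and `i + 5` at `i + 9`. -/
lemma not_small_of_middle (h : IsCyclicDoubleOccurrence f N) (hN : 8 < N) {i k : ℕ}
    (h0 : f (i + 8) = f i) (h1 : f (i + 1) = f (i + 5)) (hk : f (i + 4 + k) = f (i + 4)) :
    ¬ Small f (i + 4) k := by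
  rintro (rfl | ⟨rfl, h5, -⟩)
  · exact h.not_three i (i + 4) (i + 8) (by omega) (by omega) (by omega) (by rw [← hk, ← h0])
      hk.symm
  · exact h.not_three (i + 1) (i + 5) (i + 9) (by omega) (by omega) (by omega) h1 h5

variable [DecidableEq V]

lemma mem_single (h : IsCyclicDoubleOccurrence f N) {i k p : ℕ} (hk : k < N)
    (hik : f (i + k) = f i) (hp : i < p) (hpk : p < i + k)
    (hno : ∀ q, i < q → q < i + k → q ≠ p → f q ≠ f p) : p ∈ singlePositions f N i k := by
  rcases h.exists_other hk hik hp hpk with ⟨q, h1, h2, h3, h4⟩ | ⟨q, h1, h2, h3⟩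
  · exact absurd h4 (hno q h1 h2 h3)
  · simp only [singlePositions, Finset.mem_filter, Finset.mem_Ioo]
    exact ⟨⟨hp, hpk⟩, q, ⟨h1, h2⟩, h3⟩

lemma single_unique (h : IsCyclicDoubleOccurrence f N) {i k p q : ℕ}
    (hp : p ∈ singlePositions f N i k) (hq : i < q) (hqk : q < i + k) (hpq : f p = f q) :
    p = q := by
  simp only [singlePositions, Finset.mem_filter, Finset.mem_Ioo] at hp
  obtain ⟨⟨hp, hpk⟩, r, ⟨h1, h2⟩, h3⟩ := hp
  rcases lt_trichotomy p q with h4 | h4 | h4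
  · exact (h.not_three p q r h4 (by omega) (by omega) hpq (by rw [h3, hpq])).elim
  · exact h4
  · exact (h.not_three q p r h4 (by omega) (by omega) hpq.symm h3.symm).elim

/-- A chord whose side has the second shape lies in no larger side all of whose inner chords are
small. -/
lemma inner_eq_four (h : IsCyclicDoubleOccurrence f N)
    (hcard : ∀ i k, 0 < k → k < N → f (i + k) = f i → (singlePositions f N i k).card = 3)
    {I K : ℕ} (hK : K < N) (hIK : f (I + K) = f I)
    (ih : ∀ i k, I < i → 0 < k → i + k < I + K → f (i + k) = f i → Small f i k)
    {i k : ℕ} (hi : I < i) (hk0 : 0 < k) (hik : i + k < I + K) (hf : f (i + k) = f i) :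
    k = 4 := by
  rcases ih i k hi hk0 hik hf with rfl | ⟨rfl, h1, h3⟩
  · rfl
  exfalso
  -- The midpoint `i + 4` has no possible partner: inside the large side its chord would be small
  -- and force a third occurrence of some letter.
  rcases h.exists_other (p := i + 4) hK hIK (by omega) (by omega) with
    ⟨q, hq1, hq2, hq3, hq4⟩ | ⟨q, hq1, hq2, hq3⟩
  · rcases lt_or_gt_of_ne hq3 with hlt | hlt
    · obtain ⟨m, hm⟩ : ∃ m, i + 4 = q + m := ⟨i + 4 - q, by omega⟩
      rcases ih q m hq1 (by omega) (by omega) (by rw [← hm, hq4]) with rfl | ⟨rfl, -, h5⟩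
      · obtain rfl : i = q := by omega
        exact h.not_three i (i + 4) (i + 8) (by omega) (by omega) (by omega) hq4
          (by rw [← hq4, hf])
      · obtain rfl : i = q + 4 := by omega
        exact h.not_three (q + 3) (q + 7) (q + 11) (by omega) (by omega) (by omega) h5 h3
    · obtain ⟨m, rfl⟩ : ∃ m, q = i + 4 + m := ⟨q - (i + 4), by omega⟩
      exact h.not_small_of_middle (by omega) hf h1 hq4
        (ih (i + 4) m (by omega) (by omega) hq2 hq4)
  · obtain ⟨m, rfl⟩ : ∃ m, q = i + 4 + m := ⟨q - (i + 4), by omega⟩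
    have hc := hcard (i + 4) m (by omega) (by omega) hq3
    -- With its partner outside, the midpoint chord crosses four chords: the two of the shape, the
    -- chord of length eight and the outer one.
    have hsub : ({i + 5, i + 7, i + 8, I + K} : Finset ℕ) ⊆ singlePositions f N (i + 4) m := by
      intro p hp
      simp only [Finset.mem_insert, Finset.mem_singleton] at hp
      simp only [singlePositions, Finset.mem_filter, Finset.mem_Ioo]
      rcases hp with rfl | rfl | rfl | rfl
      · exact ⟨by omega, i + 1 + N, by omega, by rw [h.periodic, h1]⟩
      · exact ⟨by omega, i + 3 + N, by omega, by rw [h.periodic, h3]⟩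
      · exact ⟨by omega, i + N, by omega, by rw [h.periodic, hf]⟩
      · exact ⟨by omega, I + N, by omega, by rw [h.periodic, hIK]⟩
    have := Finset.card_le_card hsub
    rw [Finset.card_insert_of_notMem, Finset.card_insert_of_notMem, Finset.card_insert_of_notMem,
      Finset.card_singleton] at this
    · omega
    all_goals simp only [Finset.mem_insert, Finset.mem_singleton]; omega

/-- If all inner chords of a side have length four, then the side is small. -/
lemma small_of_inner_eq_four (h : IsCyclicDoubleOccurrence f N)
    (htwin₁ : ∀ i, f (i + 4) = f i → f (i + 5) = f (i + 1) → False)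
    (htwin₂ : ∀ i, f (i + 6) = f i → f (i + 5) = f (i + 1) → False)
    {I K : ℕ} (hcard : (singlePositions f N I K).card = 3)
    (hK : K < N) (hIK : f (I + K) = f I)
    (hinner : ∀ i k, I < i → 0 < k → i + k < I + K → f (i + k) = f i → k = 4) :
    Small f I K := by
  set S := singlePositions f N I K with hS
  -- A position that is not single is matched within the side, at distance four forward or backward.
  have hdich : ∀ t, 0 < t → t < K → I + t ∉ S →
      (t + 4 < K ∧ f (I + t + 4) = f (I + t)) ∨ (4 < t ∧ f (I + t) = f (I + (t - 4))) := by
    intro t h0 hK' hn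
    by_contra hcon
    refine hn (h.mem_single hK hIK (by omega) (by omega) fun q hq1 hq2 hq3 hq4 => hcon ?_)
    rcases lt_or_gt_of_ne hq3 with hlt | hlt
    · obtain ⟨m, hm⟩ : ∃ m, I + t = q + m := ⟨I + t - q, by omega⟩
      have := hinner q m hq1 (by omega) (by omega) (by rw [← hm, hq4])
      refine Or.inr ⟨by omega, ?_⟩
      rw [← hq4]; congr 1; omega
    · obtain ⟨m, rfl⟩ : ∃ m, q = I + t + m := ⟨q - (I + t), by omega⟩
      obtain rfl := hinner _ m (by omega) (by omega) hq2 hq4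
      exact Or.inl ⟨by omega, hq4⟩
  have hmem : ∀ p ∈ S, I < p ∧ p < I + K := by
    intro p hp
    simp only [hS, singlePositions, Finset.mem_filter, Finset.mem_Ioo] at hp
    exact hp.1
  -- Offsets up to four cannot be matched backward, and two consecutive forward matches are twins.
  have hfirst : ∀ t, 0 < t → t < 4 → t + 1 < K → I + t ∈ S ∨ I + (t + 1) ∈ S := by
    intro t h0 h4 hK'
    by_contra! hn
    rcases hdich t h0 (by omega) hn.1 with h1 | h1
    · rcases hdich (t + 1) (by omega) hK' hn.2 with h2 | h2
      · exact htwin₁ (I + t) h1.2 h2.2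
      · omega
    · omega
  have hlast : ∀ t, 0 < t → t + 1 < K → K ≤ t + 4 → I + t ∈ S ∨ I + (t + 1) ∈ S := by
    intro t h0 hK' h4
    by_contra! hn
    rcases hdich t h0 (by omega) hn.1 with h1 | h1
    · omega
    · rcases hdich (t + 1) (by omega) hK' hn.2 with h2 | h2
      · omega
      · obtain ⟨s, rfl⟩ : ∃ s, t = s + 4 := ⟨t - 4, by omega⟩
        exact htwin₁ (I + s) h1.2 (h2.2.trans (by congr 1))
  have hpair : ∀ t, 0 < t → t + 4 < K → f (I + t + 4) = f (I + t) →
      I + t ∉ S ∧ I + (t + 4) ∉ S := by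
    intro t h0 h4 hf
    refine ⟨fun hs => ?_, fun hs => ?_⟩
    · have := h.single_unique hs (q := I + t + 4) (by omega) (by omega) hf.symm
      omega
    · have := h.single_unique hs (q := I + t) (by omega) (by omega) hf
      omega
  have hfour : ∀ a b c d, a ∈ S → b ∈ S → c ∈ S → d ∈ S → a < b → b < c → c < d → False := by
    intro a b c d ha hb hc hd hab hbc hcd
    have hsub : ({a, b, c, d} : Finset ℕ) ⊆ S := by
      intro p hp
      simp only [Finset.mem_insert, Finset.mem_singleton] at hp
      rcases hp with rfl | rfl | rfl | rfl <;> assumption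
    have := Finset.card_le_card hsub
    rw [Finset.card_insert_of_notMem, Finset.card_insert_of_notMem, Finset.card_insert_of_notMem,
      Finset.card_singleton] at this
    · omega
    all_goals simp only [Finset.mem_insert, Finset.mem_singleton]; omega
  obtain ⟨a, b, c, hab, hbc, habc⟩ : ∃ a b c, a < b ∧ b < c ∧ S = {a, b, c} := by
    have e := fun x => S.orderEmbOfFin_mem hcard x
    have lt := fun x y (hxy : x < y) => (S.orderEmbOfFin hcard).strictMono hxy
    refine ⟨_, _, _, lt 0 1 (by decide), lt 1 2 (by decide), ?_⟩
    refine (Finset.eq_of_subset_of_card_le ?_ ?_).symm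
    · intro p hp
      simp only [Finset.mem_insert, Finset.mem_singleton] at hp
      rcases hp with rfl | rfl | rfl <;> exact e _
    · have l1 := lt 0 1 (by decide)
      have l2 := lt 1 2 (by decide)
      rw [hcard, Finset.card_insert_of_notMem, Finset.card_insert_of_notMem,
        Finset.card_singleton]
      all_goals simp only [Finset.mem_insert, Finset.mem_singleton]; omega
  have hSiff : ∀ p, p ∈ S ↔ p = a ∨ p = b ∨ p = c := by simp [habc]
  have ha := hmem a ((hSiff a).2 (by simp))
  have hc := hmem c ((hSiff c).2 (by simp))
  have hK3 : 4 ≤ K := by omega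
  -- From length nine on, the first four and last four inner positions are disjoint; each block has
  -- two disjoint consecutive pairs, giving four single positions.
  have h9 : K < 9 := by
    by_contra! h9
    obtain ⟨s, rfl⟩ : ∃ s, K = s + 4 := ⟨K - 4, by omega⟩
    rcases hfirst 1 (by omega) (by omega) (by omega) with h1 | h1 <;>
    rcases hfirst 3 (by omega) (by omega) (by omega) with h2 | h2 <;>
    rcases hlast s (by omega) (by omega) (by omega) with h3 | h3 <;>
    rcases hlast (s + 2) (by omega) (by omega) (by omega) with h4 | h4 <;>
    exact hfour _ _ _ _ h1 h2 h3 h4 (by omega) (by omega) (by omega)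
  have hmid : ∀ t, 0 < t → t < K → t ≤ 4 → K ≤ t + 4 → I + t ∈ S := by
    intro t h0 h1 h2 h3
    by_contra hn
    rcases hdich t h0 h1 hn with h4 | h4 <;> omega
  have hstart : ∀ t, 0 < t → t < K → t ≤ 4 → I + t ∉ S → f (I + t + 4) = f (I + t) := by
    intro t h0 h1 h2 hn
    rcases hdich t h0 h1 hn with h4 | h4
    · exact h4.2
    · omega
  have hend : ∀ t, 0 < t → t + 4 < K → K ≤ t + 8 → I + (t + 4) ∉ S →
      f (I + t + 4) = f (I + t) := by
    intro t h0 h1 h2 hn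
    rcases hdich (t + 4) (by omega) h1 hn with h4 | h4
    · omega
    · exact h4.2
  have hiff : ∀ t, 0 < t → t ≤ 4 → t + 4 < K → K ≤ t + 8 → (I + t ∈ S ↔ I + (t + 4) ∈ S) := by
    intro t h0 h1 h2 h3
    constructor
    · intro hs
      by_contra hn
      exact (hpair t h0 h2 (hend t h0 h2 h3 hn)).1 hs
    · intro hs
      by_contra hn
      exact (hpair t h0 h2 (hstart t h0 (by omega) h1 hn)).2 hs
  -- Length 5 forces four single positions. Length 6 forces 2, 3, 4 to be single, so 1 and 5 are
  -- matched, parallel to the outer chord. Length 7 makes the number of single positions even. In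
  -- length 8 they are 4 and one pair `t`, `t + 4`, where `hfirst` forces `t = 2`.
  obtain rfl | rfl | rfl | rfl | rfl : K = 4 ∨ K = 5 ∨ K = 6 ∨ K = 7 ∨ K = 8 := by omega
  · exact Or.inl rfl
  · exact (hfour _ _ _ _ (hmid 1 (by omega) (by omega) (by omega) (by omega))
      (hmid 2 (by omega) (by omega) (by omega) (by omega))
      (hmid 3 (by omega) (by omega) (by omega) (by omega))
      (hmid 4 (by omega) (by omega) (by omega) (by omega))
      (by omega) (by omega) (by omega)).elim
  · have h2 := hmid 2 (by omega) (by omega) (by omega) (by omega)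
    have h3 := hmid 3 (by omega) (by omega) (by omega) (by omega)
    have h4 := hmid 4 (by omega) (by omega) (by omega) (by omega)
    have h1 : I + 1 ∉ S := fun h1 =>
      hfour _ _ _ _ h1 h2 h3 h4 (by omega) (by omega) (by omega)
    exact (htwin₂ I hIK (hstart 1 (by omega) (by omega) (by omega) h1)).elim
  · have h3 := hmid 3 (by omega) (by omega) (by omega) (by omega)
    have h4 := hmid 4 (by omega) (by omega) (by omega) (by omega)
    have c1 := hiff 1 (by omega) (by omega) (by omega) (by omega)
    have c2 := hiff 2 (by omega) (by omega) (by omega) (by omega)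
    simp only [hSiff] at h3 h4 c1 c2
    omega
  · have h4 := hmid 4 (by omega) (by omega) (by omega) (by omega)
    have c1 := hiff 1 (by omega) (by omega) (by omega) (by omega)
    have c2 := hiff 2 (by omega) (by omega) (by omega) (by omega)
    have c3 := hiff 3 (by omega) (by omega) (by omega) (by omega)
    have f1 := hfirst 1 (by omega) (by omega) (by omega)
    have f2 := hfirst 2 (by omega) (by omega) (by omega)
    have n1 : I + 1 ∉ S := by
      simp only [hSiff] at h4 c1 c2 c3 f1 f2 ⊢
      omega
    have n3 : I + 3 ∉ S := by
      simp only [hSiff] at h4 c1 c2 c3 f1 f2 ⊢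
      omega
    exact Or.inr ⟨rfl, (hstart 1 (by omega) (by omega) (by omega) n1).symm,
      (hstart 3 (by omega) (by omega) (by omega) n3).symm⟩

/-- A cyclic double occurrence sequence in which every chord crosses exactly three others, and
which has no twin chords in two particular configurations, has period eight. -/
theorem period_eq_eight (h : IsCyclicDoubleOccurrence f N)
    (hcard : ∀ i k, 0 < k → k < N → f (i + k) = f i → (singlePositions f N i k).card = 3)
    (htwin₁ : ∀ i, f (i + 4) = f i → f (i + 5) = f (i + 1) → False)
    (htwin₂ : ∀ i, f (i + 6) = f i → f (i + 5) = f (i + 1) → False) : N = 8 := by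
  have hsmall : ∀ K, K < N → ∀ I, 0 < K → f (I + K) = f I → Small f I K := by
    intro K
    induction K using Nat.strong_induction_on with
    | _ K ih =>
      intro hK I hK0 hIK
      refine h.small_of_inner_eq_four htwin₁ htwin₂ (hcard I K hK0 hK hIK) hK hIK ?_
      intro i k hi hk0 hik hf
      exact h.inner_eq_four hcard hK hIK
        (fun i k hi hk0 hik hf => ih k (by omega) (by omega) i hk0 hf) hi hk0 hik hf
  have hfour : ∀ I K, 0 < K → K < N → f (I + K) = f I → K = 4 := by
    intro I K h0 hK hIK
    rcases hsmall K hK I h0 hIK with rfl | ⟨rfl, h1, -⟩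
    · rfl
    · obtain ⟨k, hk0, hkN, hk⟩ := h.exists_partner (I + 4)
      exact (h.not_small_of_middle hK hIK h1 hk (hsmall k hkN _ hk0 hk)).elim
  obtain ⟨k, hk0, hkN, hk⟩ := h.exists_partner 0
  have h1 := hfour 0 k hk0 hkN hk
  -- The complementary side of the same chord.
  have h2 := hfour (0 + k) (N - k) (by omega) (by omega) (by
    rw [hk, ← h.periodic 0]; congr 1; omega)
  omega

end IsCyclicDoubleOccurrence

/-! ### From words to cyclic sequences. -/

/-- The letters of a nonempty word, read cyclically. -/
def cyclicReading {V : Type*} (W : List V) (hW : 0 < W.length) (i : ℕ) : V :=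
  W[i % W.length]'(Nat.mod_lt _ hW)

section Word

variable {V : Type*} {W : List V}

lemma cyclicReading_of_lt (hW : 0 < W.length) {i : ℕ} (hi : i < W.length) :
    cyclicReading W hW i = W[i] := by
  simp [cyclicReading, Nat.mod_eq_of_lt hi]

lemma cyclicReading_mod (hW : 0 < W.length) (i : ℕ) :
    cyclicReading W hW (i % W.length) = cyclicReading W hW i := by
  simp [cyclicReading]

lemma cyclicReading_add (hW : 0 < W.length) (i : ℕ) :
    cyclicReading W hW (i + W.length) = cyclicReading W hW i := by
  simp [cyclicReading]

lemma sublist_four_iff (hW : 0 < W.length) (a b : V) :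
    List.Sublist [a, b, a, b] W ↔ ∃ p q r s, p < q ∧ q < r ∧ r < s ∧ s < W.length ∧
      cyclicReading W hW p = a ∧ cyclicReading W hW q = b ∧
      cyclicReading W hW r = a ∧ cyclicReading W hW s = b := by
  rw [List.sublist_iff_exists_fin_orderEmbedding_get_eq]
  constructor
  · rintro ⟨e, he⟩
    have lt := fun x y (hxy : x < y) => e.strictMono hxy
    refine ⟨e 0, e 1, e 2, e 3, lt 0 1 Fin.zero_lt_one, lt 1 2 (by simp [Fin.lt_def]), lt 2 3 (by simp [Fin.lt_def]),
      (e 3).2, ?_, ?_, ?_, ?_⟩ <;> rw [cyclicReading_of_lt hW (Fin.is_lt _)]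
    · exact (he 0).symm
    · exact (he 1).symm
    · exact (he 2).symm
    · exact (he 3).symm
  · rintro ⟨p, q, r, s, hpq, hqr, hrs, hs, h0, h1, h2, h3⟩
    rw [cyclicReading_of_lt hW (by omega)] at h0 h1 h2 h3
    let g : Fin 4 → Fin W.length :=
      ![⟨p, by omega⟩, ⟨q, by omega⟩, ⟨r, by omega⟩, ⟨s, by omega⟩]
    have hg : StrictMono g := by
      rw [Fin.strictMono_iff_lt_succ]
      intro i
      fin_cases i
      · exact hpq
      · exact hqr
      · exact hrs
    refine ⟨OrderEmbedding.ofStrictMono g hg, fun i => ?_⟩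
    fin_cases i
    · exact h0.symm
    · exact h1.symm
    · exact h2.symm
    · exact h3.symm

lemma card_positions_eq_count [DecidableEq V] (W : List V) (v : V) :
    {p ∈ Finset.range W.length | W[p]? = some v}.card = W.count v := by
  induction W using List.reverseRecOn with
  | nil => simp
  | append_singleton W x ih =>
    rw [List.length_append, List.length_singleton, Finset.range_add_one, Finset.filter_insert,
      List.count_append, ← ih]
    have hcongr : {p ∈ Finset.range W.length | (W ++ [x])[p]? = some v} =
        {p ∈ Finset.range W.length | W[p]? = some v} := by
      refine Finset.filter_congr fun p hp => ?_
      rw [List.getElem?_append_left (Finset.mem_range.1 hp)]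
    rw [hcongr]
    by_cases hx : x = v <;> simp [hx]

lemma IsDoubleOccurrenceWord.isCyclicDoubleOccurrence [DecidableEq V]
    (h : IsDoubleOccurrenceWord W) (hW : 0 < W.length) : IsCyclicDoubleOccurrence (cyclicReading W hW) W.length := by
  set f := cyclicReading W hW with hf
  have hcard : ∀ v, {p ∈ Finset.range W.length | f p = v}.card = 2 := by
    intro v
    rw [← h v, ← card_positions_eq_count]
    congr 1
    refine Finset.filter_congr fun p hp => ?_
    rw [hf, cyclicReading_of_lt hW (Finset.mem_range.1 hp),
      List.getElem?_eq_getElem (Finset.mem_range.1 hp), Option.some_inj]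
  have hmod : ∀ i, f (i % W.length) = f i := cyclicReading_mod hW
  refine ⟨cyclicReading_add hW, fun i => ?_, fun a b c hab hbc hca h1 h2 => ?_⟩
  · have hi : i % W.length ∈ ({p ∈ Finset.range W.length | f p = f i} : Finset ℕ) := by
      simp [Nat.mod_lt _ hW, hmod]
    obtain ⟨p, hp, hne⟩ := Finset.exists_mem_ne (by rw [hcard (f i)]; norm_num) (i % W.length)
    simp only [Finset.mem_filter, Finset.mem_range] at hp
    have hlt := Nat.mod_lt i hW
    have hdiv := Nat.mod_add_div i W.length
    rcases lt_or_gt_of_ne hne with hlt' | hlt'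
    -- The other occurrence precedes `i` within the period, so its copy one period later is used.
    · refine ⟨p + W.length - i % W.length, by omega, by omega, ?_⟩
      rw [← hp.2, ← hmod (i + _), ← Nat.mod_eq_of_lt hp.1]
      rw [show i + (p % W.length + W.length - i % W.length) =
          p + W.length + W.length * (i / W.length) by
        rw [Nat.mod_eq_of_lt hp.1]; omega]
      simp [hmod]
    · refine ⟨p - i % W.length, by omega, by omega, ?_⟩
      rw [← hp.2, ← hmod (i + _)]
      rw [show i + (p - i % W.length) = p + W.length * (i / W.length) by omega]
      simp [hmod]
  · have hne : ∀ x y, x < y → y < x + W.length → x % W.length ≠ y % W.length := by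
      intro x y hxy hyx e
      have h1 := (Nat.modEq_iff_dvd' hxy.le).1 e
      have := Nat.le_of_dvd (by omega) h1
      omega
    have hsub : ({a % W.length, b % W.length, c % W.length} : Finset ℕ) ⊆
        {p ∈ Finset.range W.length | f p = f a} := by
      intro p hp
      simp only [Finset.mem_insert, Finset.mem_singleton] at hp
      rcases hp with rfl | rfl | rfl <;> simp [hmod, Nat.mod_lt _ hW, h1, h2]
    have hle := Finset.card_le_card hsub
    have hab' := hne a b hab (by omega)
    have hac' := hne a c (by omega) (by omega)
    have hbc' := hne b c hbc (by omega)
    rw [hcard, Finset.card_insert_of_notMem (by simp [hab', hac']),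
      Finset.card_insert_of_notMem (by simp [hbc']), Finset.card_singleton] at hle
    omega

lemma IsCyclicDoubleOccurrence.interlacementGraph_adj_iff_of_lt {hW : 0 < W.length}
    (h : IsCyclicDoubleOccurrence (cyclicReading W hW) W.length) {i k : ℕ} (hk : 0 < k)
    (hlt : i + k < W.length) (hik : cyclicReading W hW (i + k) = cyclicReading W hW i) (b : V) :
    (interlacementGraph W).Adj (cyclicReading W hW i) b ↔
      ∃ p q, i < p ∧ p < i + k ∧ i + k < q ∧ q < i + W.length ∧
        cyclicReading W hW p = b ∧ cyclicReading W hW q = b := by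
  set f := cyclicReading W hW with hf
  have huniq : ∀ x y, x < y → y < W.length → f x = f i → f y = f i → x = i ∧ y = i + k := by
    have hmem : ∀ x, x < W.length → f x = f i → x = i ∨ x = i + k := by
      intro x hxN hx
      by_contra! hne
      rcases lt_or_gt_of_ne hne.1 with h1 | h1
      · exact h.not_three x i (i + k) h1 (by omega) (by omega) hx hik.symm
      rcases lt_or_gt_of_ne hne.2 with h2 | h2
      · exact h.not_three i x (i + k) h1 h2 (by omega) hx.symm (by rw [hx, hik])
      · exact h.not_three i (i + k) x (by omega) h2 (by omega) hik.symm (by rw [hx, hik])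
    intro x y hxy hy hx hy'
    have := hmem x (by omega) hx
    have := hmem y hy hy'
    omega
  simp only [interlacementGraph, sublist_four_iff hW]
  constructor
  · rintro ⟨-, ⟨p, q, r, s, hpq, hqr, hrs, hs, h0, h1, h2, h3⟩ |
      ⟨p, q, r, s, hpq, hqr, hrs, hs, h0, h1, h2, h3⟩⟩
    · obtain ⟨rfl, rfl⟩ := huniq p r (by omega) (by omega) h0 h2
      exact ⟨q, s, hpq, hqr, hrs, by omega, h1, h3⟩
    · obtain ⟨rfl, rfl⟩ := huniq q s (by omega) (by omega) h1 h3
      -- In the order `baba` the first `b` precedes the chord; one period later it lies on the far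
      -- side.
      exact ⟨r, p + W.length, hqr, hrs, by omega, by omega, h2, (h.periodic p).trans h0⟩
  · rintro ⟨p, q, hp, hpk, hq, hqN, rfl, h1⟩
    refine ⟨fun e => h.not_three i p (i + k) hp hpk (by omega) e (by rw [hik, e]), ?_⟩
    rcases lt_or_ge q W.length with hq' | hq'
    · exact Or.inl ⟨i, p, i + k, q, hp, hpk, hq, hq', rfl, rfl, hik, h1⟩
    · obtain ⟨r, rfl⟩ : ∃ r, q = r + W.length := ⟨q - W.length, by omega⟩
      rw [h.periodic] at h1
      exact Or.inr ⟨r, i, p, i + k, by omega, hp, hpk, hlt, h1, rfl, rfl, hik⟩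

/-- Crossing does not depend on where the cycle is cut: a chord that wraps around is replaced by its
complementary side, which swaps the two witnesses, and a start beyond one period is shifted back. -/
lemma IsCyclicDoubleOccurrence.interlacementGraph_adj_iff {hW : 0 < W.length}
    (h : IsCyclicDoubleOccurrence (cyclicReading W hW) W.length) {i k : ℕ} (hk : 0 < k)
    (hkN : k < W.length) (hik : cyclicReading W hW (i + k) = cyclicReading W hW i) (b : V) :
    (interlacementGraph W).Adj (cyclicReading W hW i) b ↔
      ∃ p q, i < p ∧ p < i + k ∧ i + k < q ∧ q < i + W.length ∧
        cyclicReading W hW p = b ∧ cyclicReading W hW q = b := by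
  induction i using Nat.strong_induction_on with
  | _ i ih =>
    rcases lt_or_ge (i + k) W.length with hlt | hge
    · exact h.interlacementGraph_adj_iff_of_lt hk hlt hik b
    rcases lt_or_ge i W.length with hi | hi
    · obtain ⟨j, hj⟩ : ∃ j, i + k = j + W.length := ⟨i + k - W.length, by omega⟩
      obtain ⟨m, hm⟩ : ∃ m, i = j + m := ⟨i - j, by omega⟩
      have hji : cyclicReading W hW j = cyclicReading W hW i := by
        rw [← h.periodic j, ← hj, hik]
      rw [← hji, h.interlacementGraph_adj_iff_of_lt (i := j) (k := m) (by omega) (by omega)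
        (by rw [← hm, hji])]
      constructor
      · rintro ⟨p, q, h1, h2, h3, h4, h5, h6⟩
        exact ⟨q, p + W.length, by omega, by omega, by omega, by omega, h6,
          by rw [h.periodic, h5]⟩
      · rintro ⟨p, q, h1, h2, h3, h4, h5, h6⟩
        obtain ⟨r, rfl⟩ : ∃ r, q = r + W.length := ⟨q - W.length, by omega⟩
        exact ⟨r, p, by omega, by omega, by omega, by omega, by rw [← h.periodic, h6], h5⟩
    · obtain ⟨j, rfl⟩ : ∃ j, i = j + W.length := ⟨i - W.length, by omega⟩
      have e : cyclicReading W hW (j + W.length + k) = cyclicReading W hW (j + k) := by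
        rw [← h.periodic (j + k)]; congr 1; omega
      rw [h.periodic] at hik ⊢
      rw [e] at hik
      rw [ih j (by omega) hik]
      constructor
      · rintro ⟨p, q, h1, h2, h3, h4, h5, h6⟩
        exact ⟨p + W.length, q + W.length, by omega, by omega, by omega, by omega,
          by rw [h.periodic, h5], by rw [h.periodic, h6]⟩
      · rintro ⟨p, q, h1, h2, h3, h4, h5, h6⟩
        obtain ⟨r, rfl⟩ : ∃ r, q = r + W.length := ⟨q - W.length, by omega⟩
        obtain ⟨s, rfl⟩ : ∃ s, p = s + W.length := ⟨p - W.length, by omega⟩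
        exact ⟨s, r, by omega, by omega, by omega, by omega, by rw [← h.periodic, h5],
          by rw [← h.periodic, h6]⟩

end Word

/-! ### Twins, splits and the conclusion. -/

lemma SimpleGraph.exists_isSplit_of_twins {V : Type*} (G : SimpleGraph V)
    (hcard : 5 ≤ ENat.card V) {a b : V} (hab : a ≠ b)
    (htwin : ∀ c, c ≠ a → c ≠ b → (G.Adj a c ↔ G.Adj b c)) :
    ∃ V₁ X₁ V₂ X₂ : Set V, IsSplit G V₁ X₁ V₂ X₂ := by
  refine ⟨{a, b}, {a, b}, {a, b}ᶜ, {c | c ∉ ({a, b} : Set V) ∧ G.Adj a c}, ?_⟩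
  refine ⟨Set.union_compl_self _, disjoint_compl_right, (Set.encard_pair hab).ge, ?_, subset_rfl,
    fun c hc => hc.1, ?_⟩
  · by_contra! hlt
    have h1 := Set.encard_add_encard_compl ({a, b} : Set V)
    rw [Set.encard_pair hab, Set.encard_univ] at h1
    rw [← h1] at hcard
    have h2 : (2 : ℕ∞) + ({a, b}ᶜ : Set V).encard ≤ 2 + 2 := by gcongr
    exact absurd (hcard.trans h2) (by norm_num)
  · intro x hx c hc
    have hc' : c ≠ a ∧ c ≠ b := by simpa using hc
    rcases hx with rfl | rfl
    · simp [hc'.1, hc'.2]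
    · simp [hc'.1, hc'.2, htwin c hc'.1 hc'.2]

theorem corollary3 {V : Type*} [Fintype V] [DecidableEq V] (G : SimpleGraph V)
    [DecidableRel G.Adj] (hreg : G.IsRegularOfDegree 3) (hcircle : IsCircleGraph G) :
    ¬ IsPrimeGraph G := by
  rintro ⟨hcard, hsplit⟩
  obtain ⟨W, hW, rfl⟩ := hcircle
  have hcard' : 5 ≤ Fintype.card V := by
    rw [ENat.card_eq_coe_fintype_card] at hcard
    exact_mod_cast hcard
  have hlen : W.length = 2 * Fintype.card V := by
    rw [← Multiset.coe_card, ← Multiset.sum_count_eq_card (s := Finset.univ) (by simp)]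
    simp [hW _, mul_comm]
  have hpos : 0 < W.length := by omega
  have h := hW.isCyclicDoubleOccurrence hpos
  have hadj := fun i k => h.interlacementGraph_adj_iff (i := i) (k := k)
  set f := cyclicReading W hpos with hf
  have htwin : ∀ a b, a ≠ b → ¬ ∀ c, c ≠ a → c ≠ b →
      ((interlacementGraph W).Adj a c ↔ (interlacementGraph W).Adj b c) :=
    fun a b hab ht => hsplit ((interlacementGraph W).exists_isSplit_of_twins hcard hab ht)
  have h8 : W.length = 8 := by
    refine h.period_eq_eight ?_ ?_ ?_
    · intro i k hk hkN hik
      rw [← hreg (f i), ← SimpleGraph.card_neighborFinset_eq_degree]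
      -- A neighbour is a letter with one occurrence on each side, hence exactly one single
      -- position.
      refine Finset.card_bij (fun p _ => f p) ?_ ?_ ?_
      · intro p hp
        rw [SimpleGraph.mem_neighborFinset, hadj i k hk hkN hik]
        simp only [singlePositions, Finset.mem_filter, Finset.mem_Ioo] at hp
        obtain ⟨⟨h1, h2⟩, q, ⟨h3, h4⟩, h5⟩ := hp
        exact ⟨p, q, h1, h2, h3, h4, rfl, h5⟩
      · intro p hp q hq hpq
        have hq' := Finset.mem_Ioo.1 (Finset.mem_filter.1 hq).1
        exact h.single_unique hp hq'.1 hq'.2 hpq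
      · intro b hb
        rw [SimpleGraph.mem_neighborFinset, hadj i k hk hkN hik] at hb
        obtain ⟨p, q, h1, h2, h3, h4, h5, h6⟩ := hb
        refine ⟨p, ?_, h5⟩
        simp only [singlePositions, Finset.mem_filter, Finset.mem_Ioo]
        exact ⟨⟨h1, h2⟩, q, ⟨h3, h4⟩, by rw [h5, h6]⟩
    -- The two chords cross and have adjacent ends; a third chord avoids these ends, so it crosses
    -- both or neither, with the same witnesses.
    · intro i h1 h2
      refine htwin (f i) (f (i + 1)) (fun e => h.not_three i (i + 1) (i + 4) (by omega) (by omega)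
        (by omega) e (by rw [← e, h1])) fun c hca hcb => ?_
      rw [hadj i 4 (by omega) (by omega) h1, hadj (i + 1) 4 (by omega) (by omega) h2]
      constructor <;> rintro ⟨p, q, g1, g2, g3, g4, g5, rfl⟩
      · have n1 : p ≠ i + 1 := fun e => hcb (by rw [← g5, e])
        have n2 : q ≠ i + 5 := fun e => hcb (by rw [← h2, e])
        exact ⟨p, q, by omega, by omega, by omega, by omega, g5, rfl⟩
      · have n1 : p ≠ i + 4 := fun e => hca (by rw [← g5, e, h1])
        have n2 : q ≠ i + W.length := fun e => hca (by rw [e, h.periodic])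
        exact ⟨p, q, by omega, by omega, by omega, by omega, g5, rfl⟩
    -- The same for two parallel chords, one just inside the other.
    · intro i h1 h2
      refine htwin (f i) (f (i + 1)) (fun e => h.not_three i (i + 1) (i + 6) (by omega) (by omega)
        (by omega) e (by rw [← e, h1])) fun c hca hcb => ?_
      rw [hadj i 6 (by omega) (by omega) h1, hadj (i + 1) 4 (by omega) (by omega) h2]
      constructor <;> rintro ⟨p, q, g1, g2, g3, g4, g5, rfl⟩
      · have n1 : p ≠ i + 1 := fun e => hcb (by rw [← g5, e])
        have n2 : p ≠ i + 5 := fun e => hcb (by rw [← g5, e, h2])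
        exact ⟨p, q, by omega, by omega, by omega, by omega, g5, rfl⟩
      · have n1 : q ≠ i + 6 := fun e => hca (by rw [← h1, e])
        have n2 : q ≠ i + W.length := fun e => hca (by rw [e, h.periodic])
        exact ⟨p, q, by omega, by omega, by omega, by omega, g5, rfl⟩
  omega
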